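/- Let $R$ be a prime ring, i.e. an associative ring $R\neq 0$, not necessarily with unity, such that $aRb=0$ implies $a=0$ or $b=0$. Let $Z(R)$ be its center, $Q_s(R)\supseteq R$ its Martindale symmetric ring of quotients and $C$ (the extended centroid) the center of $Q_s(R)$. Write $[x,y]=xy-yx$; for additive subgroups $A,B$ let $[A,B]$ (resp. $AB$) be the additive subgroup generated by all $[x,y]$ (resp. $xy$) with $x\in A$, $y\in B$. In particular $LC$ and $RC$ are additive subgroups of $Q_s(R)$, and $RC$ is a subring. "Ideal" means two-sided ideal. A Lie ideal of $R$ is an additive subgroup $L$ with $[L,R]\subseteq L$; it is called abelian if $[L,L]=0$ and noncentral if $L\not\subseteq Z(R)$. For $a\in R$ let $aL=\{ax : x\in L\}$. Let $L$ be a noncentral Lie ideal of $R$ and let $a\in R$. Case 1: Suppose that $L$ is not abelian. If $a\notin Z(R)$, then $L+aL$ contains a nonzero ideal of $R$. Case 2: Suppose that $L$ is abelian. Then there is $b\in L\setminus Z(R)$ with $LC=Cb+C$, and for every such $b$ the following hold: (i) if $a\in LC$, then $L+aL$ contains no nonzero ideal of $R$; (ii) if $a\in[RC,RC]\setminus LC$,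 then $L+aL$ contains a nonzero ideal of $R$; (iii) if $a\notin[RC,RC]$, then $L+aL$ contains a nonzero ideal of $R$ if and only if $[a,b]$ is a unit of $RC$. -/

import Mathlib

/-- A (not necessarily unital) associative ring `R ≠ 0` is prime if `aRb = 0` implies
`a = 0` or `b = 0`. -/
class IsPrimeRing (R : Type*) [NonUnitalRing R] : Prop extends Nontrivial R where
  eq_zero_or_eq_zero : ∀ a b : R, (∀ r : R, a * r * b = 0) → a = 0 ∨ b = 0

/-! ### The Martindale symmetric ring of quotients -/

section NonzeroIdeals

variable {R : Type*} [NonUnitalRing R]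

theorem TwoSidedIdeal.exists_ne_zero_of_ne_bot {I : TwoSidedIdeal R} (hI : I ≠ ⊥) :
    ∃ a ∈ I, a ≠ 0 := by
  by_contra! h
  exact hI (le_antisymm (fun x hx => (TwoSidedIdeal.mem_bot R).2 (h x hx)) bot_le)

theorem TwoSidedIdeal.ne_bot_of_mem {I : TwoSidedIdeal R} {a : R} (ha : a ∈ I) (h0 : a ≠ 0) :
    I ≠ ⊥ := by
  rintro rfl
  exact h0 ((TwoSidedIdeal.mem_bot R).1 ha)

/-- The ideal `I²`: all finite sums of products of two elements of `I`. -/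
def TwoSidedIdeal.square (I : TwoSidedIdeal R) : TwoSidedIdeal R :=
  TwoSidedIdeal.mk' (AddSubgroup.closure {z : R | ∃ x ∈ I, ∃ y ∈ I, z = x * y} : Set R)
    (AddSubgroup.zero_mem _) (fun hx hy => AddSubgroup.add_mem _ hx hy) (fun hx => AddSubgroup.neg_mem _ hx)
    (by
      intro x y hy
      change x * y ∈ AddSubgroup.closure {z : R | ∃ x ∈ I, ∃ y ∈ I, z = x * y}
      induction hy using AddSubgroup.closure_induction with
      | mem z hz =>
        obtain ⟨a, ha, b, hb, rfl⟩ := hz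
        exact AddSubgroup.subset_closure ⟨x * a, I.mul_mem_left _ _ ha, b, hb, by rw [mul_assoc]⟩
      | zero => rw [mul_zero]; exact AddSubgroup.zero_mem _
      | add a b _ _ ha hb => rw [mul_add]; exact AddSubgroup.add_mem _ ha hb
      | neg a _ ha => rw [mul_neg]; exact AddSubgroup.neg_mem _ ha)
    (by
      intro y x hy
      change y * x ∈ AddSubgroup.closure {z : R | ∃ x ∈ I, ∃ y ∈ I, z = x * y}
      induction hy using AddSubgroup.closure_induction with
      | mem z hz =>
        obtain ⟨a, ha, b, hb, rfl⟩ := hz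
        exact AddSubgroup.subset_closure ⟨a, ha, b * x, I.mul_mem_right _ _ hb, by rw [mul_assoc]⟩
      | zero => rw [zero_mul]; exact AddSubgroup.zero_mem _
      | add a b _ _ ha hb => rw [add_mul]; exact AddSubgroup.add_mem _ ha hb
      | neg a _ ha => rw [neg_mul]; exact AddSubgroup.neg_mem _ ha)

theorem TwoSidedIdeal.mem_square {I : TwoSidedIdeal R} {z : R} :
    z ∈ I.square ↔ z ∈ AddSubgroup.closure {z : R | ∃ x ∈ I, ∃ y ∈ I, z = x * y} := by
  simp [TwoSidedIdeal.square]

theorem TwoSidedIdeal.mul_mem_square {I : TwoSidedIdeal R} {x y : R} (hx : x ∈ I) (hy : y ∈ I) :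
    x * y ∈ I.square :=
  TwoSidedIdeal.mem_square.2 (AddSubgroup.subset_closure ⟨x, hx, y, hy, rfl⟩)

theorem TwoSidedIdeal.square_le (I : TwoSidedIdeal R) : I.square ≤ I := by
  intro z hz
  rw [TwoSidedIdeal.mem_square] at hz
  induction hz using AddSubgroup.closure_induction with
  | mem z hz =>
    obtain ⟨a, ha, b, hb, rfl⟩ := hz
    exact I.mul_mem_left _ _ hb
  | zero => exact I.zero_mem
  | add a b _ _ ha hb => exact I.add_mem ha hb
  | neg a _ ha => exact I.neg_mem ha

theorem TwoSidedIdeal.square_mono {I J : TwoSidedIdeal R} (h : I ≤ J) : I.square ≤ J.square := by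
  intro z hz
  rw [TwoSidedIdeal.mem_square] at hz ⊢
  refine AddSubgroup.closure_mono ?_ hz
  rintro z ⟨x, hx, y, hy, rfl⟩
  exact ⟨x, h hx, y, h hy, rfl⟩

variable [IsPrimeRing R]

theorem TwoSidedIdeal.inf_ne_bot {I J : TwoSidedIdeal R} (hI : I ≠ ⊥) (hJ : J ≠ ⊥) :
    I ⊓ J ≠ ⊥ := by
  obtain ⟨a, ha, ha0⟩ := TwoSidedIdeal.exists_ne_zero_of_ne_bot hI
  obtain ⟨b, hb, hb0⟩ := TwoSidedIdeal.exists_ne_zero_of_ne_bot hJ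
  have h : ∃ r, a * r * b ≠ 0 := by
    by_contra! h
    exact (IsPrimeRing.eq_zero_or_eq_zero a b h).elim ha0 hb0
  obtain ⟨r, hr⟩ := h
  exact TwoSidedIdeal.ne_bot_of_mem (a := a * r * b)
    ((TwoSidedIdeal.mem_inf R).2 ⟨I.mul_mem_right _ _ (I.mul_mem_right _ _ ha),
      J.mul_mem_left _ _ hb⟩) hr

theorem TwoSidedIdeal.square_ne_bot {I : TwoSidedIdeal R} (hI : I ≠ ⊥) : I.square ≠ ⊥ := by
  obtain ⟨a, ha, ha0⟩ := TwoSidedIdeal.exists_ne_zero_of_ne_bot hI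
  have h : ∃ r, a * r * a ≠ 0 := by
    by_contra! h
    exact (IsPrimeRing.eq_zero_or_eq_zero a a h).elim ha0 ha0
  obtain ⟨r, hr⟩ := h
  exact TwoSidedIdeal.ne_bot_of_mem (TwoSidedIdeal.mul_mem_square (I.mul_mem_right a r ha) ha) hr

theorem TwoSidedIdeal.top_ne_bot' : (⊤ : TwoSidedIdeal R) ≠ ⊥ := by
  obtain ⟨a, ha⟩ := exists_ne (0 : R)
  exact TwoSidedIdeal.ne_bot_of_mem (a := a) (TwoSidedIdeal.mem_top R) ha

end NonzeroIdeals

/-- A triple `(f, g, I)` with `I` a nonzero ideal of `R`, `f : I → R` a homomorphism of right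
`R`-modules and `g : I → R` a homomorphism of left `R`-modules, such that `x f(y) = g(x) y`
for all `x, y ∈ I`.  The maps are extended to `R` by arbitrary values outside `I`; these values
are discarded by `SymPair.Rel`. -/
structure SymPair (R : Type*) [NonUnitalRing R] where
  I : TwoSidedIdeal R
  ne_bot : I ≠ ⊥
  f : R → R
  g : R → R
  f_add : ∀ x ∈ I, ∀ y ∈ I, f (x + y) = f x + f y
  f_mul : ∀ x ∈ I, ∀ r, f (x * r) = f x * r
  g_add : ∀ x ∈ I, ∀ y ∈ I, g (x + y) = g x + g y
  g_mul : ∀ x ∈ I, ∀ r, g (r * x) = r * g x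
  compat : ∀ x ∈ I, ∀ y ∈ I, x * f y = g x * y

namespace SymPair

variable {R : Type*} [NonUnitalRing R]

/-- Two triples are identified if their maps agree on a nonzero ideal contained in both
domains. -/
def Rel (p q : SymPair R) : Prop :=
  ∃ J : TwoSidedIdeal R, J ≠ ⊥ ∧ J ≤ p.I ∧ J ≤ q.I ∧ ∀ x ∈ J, p.f x = q.f x ∧ p.g x = q.g x

theorem f_zero (p : SymPair R) : p.f 0 = 0 := by
  have := p.f_add 0 p.I.zero_mem 0 p.I.zero_mem
  simpa using this

theorem g_zero (p : SymPair R) : p.g 0 = 0 := by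
  have := p.g_add 0 p.I.zero_mem 0 p.I.zero_mem
  simpa using this

theorem f_neg (p : SymPair R) {x : R} (hx : x ∈ p.I) : p.f (-x) = -p.f x := by
  have := p.f_add x hx (-x) (p.I.neg_mem hx)
  rw [add_neg_cancel, f_zero] at this
  exact (neg_eq_of_add_eq_zero_right this.symm).symm

theorem g_neg (p : SymPair R) {x : R} (hx : x ∈ p.I) : p.g (-x) = -p.g x := by
  have := p.g_add x hx (-x) (p.I.neg_mem hx)
  rw [add_neg_cancel, g_zero] at this
  exact (neg_eq_of_add_eq_zero_right this.symm).symm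

theorem f_mem_of_mem_square (p : SymPair R) {J : TwoSidedIdeal R} (hJ : J ≤ p.I) {x : R}
    (hx : x ∈ J.square) : p.f x ∈ J := by
  have key : x ∈ p.I ∧ p.f x ∈ J := by
    rw [TwoSidedIdeal.mem_square] at hx
    induction hx using AddSubgroup.closure_induction with
    | mem z hz =>
      obtain ⟨a, ha, b, hb, rfl⟩ := hz
      exact ⟨p.I.mul_mem_right _ _ (hJ ha), by
        rw [p.f_mul a (hJ ha)]; exact J.mul_mem_left _ _ hb⟩
    | zero => exact ⟨p.I.zero_mem, by rw [p.f_zero]; exact J.zero_mem⟩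
    | add a b _ _ ha hb =>
      exact ⟨p.I.add_mem ha.1 hb.1, by rw [p.f_add a ha.1 b hb.1]; exact J.add_mem ha.2 hb.2⟩
    | neg a _ ha => exact ⟨p.I.neg_mem ha.1, by rw [p.f_neg ha.1]; exact J.neg_mem ha.2⟩
  exact key.2

theorem g_mem_of_mem_square (p : SymPair R) {J : TwoSidedIdeal R} (hJ : J ≤ p.I) {x : R}
    (hx : x ∈ J.square) : p.g x ∈ J := by
  have key : x ∈ p.I ∧ p.g x ∈ J := by
    rw [TwoSidedIdeal.mem_square] at hx
    induction hx using AddSubgroup.closure_induction with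
    | mem z hz =>
      obtain ⟨a, ha, b, hb, rfl⟩ := hz
      exact ⟨p.I.mul_mem_right _ _ (hJ ha), by
        rw [p.g_mul b (hJ hb)]; exact J.mul_mem_right _ _ ha⟩
    | zero => exact ⟨p.I.zero_mem, by rw [p.g_zero]; exact J.zero_mem⟩
    | add a b _ _ ha hb =>
      exact ⟨p.I.add_mem ha.1 hb.1, by rw [p.g_add a ha.1 b hb.1]; exact J.add_mem ha.2 hb.2⟩
    | neg a _ ha => exact ⟨p.I.neg_mem ha.1, by rw [p.g_neg ha.1]; exact J.neg_mem ha.2⟩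
  exact key.2

/-- Pointwise negation. -/
def neg (p : SymPair R) : SymPair R where
  I := p.I
  ne_bot := p.ne_bot
  f x := -p.f x
  g x := -p.g x
  f_add x hx y hy := by rw [p.f_add x hx y hy, neg_add]
  f_mul x hx r := by rw [p.f_mul x hx, neg_mul]
  g_add x hx y hy := by rw [p.g_add x hx y hy, neg_add]
  g_mul x hx r := by rw [p.g_mul x hx, mul_neg]
  compat x hx y hy := by rw [mul_neg, neg_mul, p.compat x hx y hy]

theorem neg_congr {p p' : SymPair R} (hp : Rel p p') : Rel p.neg p'.neg := by
  obtain ⟨J, h0, h1, h2, h⟩ := hp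
  refine ⟨J, h0, h1, h2, fun x hx => ?_⟩
  simp only [neg, (h x hx).1, (h x hx).2, and_self]

variable [IsPrimeRing R]

instance setoid (R : Type*) [NonUnitalRing R] [IsPrimeRing R] : Setoid (SymPair R) where
  r := Rel
  iseqv :=
    { refl := fun p => ⟨p.I, p.ne_bot, le_rfl, le_rfl, fun _ _ => ⟨rfl, rfl⟩⟩
      symm := fun ⟨J, h0, h1, h2, h⟩ =>
        ⟨J, h0, h2, h1, fun x hx => ⟨(h x hx).1.symm, (h x hx).2.symm⟩⟩
      trans := fun ⟨J, h0, h1, _, h⟩ ⟨K, k0, _, k2, k⟩ =>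
        ⟨J ⊓ K, TwoSidedIdeal.inf_ne_bot h0 k0, inf_le_left.trans h1, inf_le_right.trans k2,
          fun x hx => ⟨(h x hx.1).1.trans (k x hx.2).1, (h x hx.1).2.trans (k x hx.2).2⟩⟩ }

/-- Left and right multiplication by `a`, defined on all of `R`. -/
def ofElem (a : R) : SymPair R where
  I := ⊤
  ne_bot := TwoSidedIdeal.top_ne_bot'
  f x := a * x
  g x := x * a
  f_add _ _ _ _ := mul_add _ _ _
  f_mul _ _ _ := (mul_assoc _ _ _).symm
  g_add _ _ _ _ := add_mul _ _ _
  g_mul _ _ _ := mul_assoc _ _ _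
  compat _ _ _ _ := (mul_assoc _ _ _).symm

/-- The pair of identity maps, defined on all of `R`. -/
def one : SymPair R where
  I := ⊤
  ne_bot := TwoSidedIdeal.top_ne_bot'
  f x := x
  g x := x
  f_add _ _ _ _ := rfl
  f_mul _ _ _ := rfl
  g_add _ _ _ _ := rfl
  g_mul _ _ _ := rfl
  compat _ _ _ _ := rfl

/-- Pointwise addition on the intersection of the domains. -/
def add (p q : SymPair R) : SymPair R where
  I := p.I ⊓ q.I
  ne_bot := TwoSidedIdeal.inf_ne_bot p.ne_bot q.ne_bot
  f x := p.f x + q.f x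
  g x := p.g x + q.g x
  f_add x hx y hy := by rw [p.f_add x hx.1 y hy.1, q.f_add x hx.2 y hy.2]; abel
  f_mul x hx r := by rw [p.f_mul x hx.1, q.f_mul x hx.2, add_mul]
  g_add x hx y hy := by rw [p.g_add x hx.1 y hy.1, q.g_add x hx.2 y hy.2]; abel
  g_mul x hx r := by rw [p.g_mul x hx.1, q.g_mul x hx.2, mul_add]
  compat x hx y hy := by rw [mul_add, add_mul, p.compat x hx.1 y hy.1, q.compat x hx.2 y hy.2]

/-- Composition, `(f, g) (f', g') = (f ∘ f', g' ∘ g)`, on the square of the intersection of the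
domains (which each map sends into that intersection). -/
def mul (p q : SymPair R) : SymPair R where
  I := (p.I ⊓ q.I).square
  ne_bot := TwoSidedIdeal.square_ne_bot (TwoSidedIdeal.inf_ne_bot p.ne_bot q.ne_bot)
  f x := p.f (q.f x)
  g x := q.g (p.g x)
  f_add x hx y hy := by
    rw [q.f_add x (TwoSidedIdeal.square_le _ hx).2 y (TwoSidedIdeal.square_le _ hy).2,
      p.f_add _ (q.f_mem_of_mem_square inf_le_right hx).1 _
        (q.f_mem_of_mem_square inf_le_right hy).1]
  f_mul x hx r := by
    rw [q.f_mul x (TwoSidedIdeal.square_le _ hx).2,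
      p.f_mul _ (q.f_mem_of_mem_square inf_le_right hx).1]
  g_add x hx y hy := by
    rw [p.g_add x (TwoSidedIdeal.square_le _ hx).1 y (TwoSidedIdeal.square_le _ hy).1,
      q.g_add _ (p.g_mem_of_mem_square inf_le_left hx).2 _
        (p.g_mem_of_mem_square inf_le_left hy).2]
  g_mul x hx r := by
    rw [p.g_mul x (TwoSidedIdeal.square_le _ hx).1,
      q.g_mul _ (p.g_mem_of_mem_square inf_le_left hx).2]
  compat x hx y hy := by
    rw [p.compat x (TwoSidedIdeal.square_le _ hx).1 _
        (q.f_mem_of_mem_square inf_le_right hy).1,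
      q.compat _ (p.g_mem_of_mem_square inf_le_left hx).2 y (TwoSidedIdeal.square_le _ hy).2]

theorem add_congr {p p' q q' : SymPair R} (hp : Rel p p') (hq : Rel q q') :
    Rel (p.add q) (p'.add q') := by
  obtain ⟨J, h0, h1, h2, h⟩ := hp
  obtain ⟨K, k0, k1, k2, k⟩ := hq
  refine ⟨J ⊓ K, TwoSidedIdeal.inf_ne_bot h0 k0, inf_le_inf h1 k1, inf_le_inf h2 k2, ?_⟩
  intro x hx
  simp only [add, (h x hx.1).1, (h x hx.1).2, (k x hx.2).1, (k x hx.2).2, and_self]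

theorem mul_congr {p p' q q' : SymPair R} (hp : Rel p p') (hq : Rel q q') :
    Rel (p.mul q) (p'.mul q') := by
  obtain ⟨J, h0, h1, h2, h⟩ := hp
  obtain ⟨K, k0, k1, k2, k⟩ := hq
  refine ⟨(J ⊓ K).square, TwoSidedIdeal.square_ne_bot (TwoSidedIdeal.inf_ne_bot h0 k0),
    TwoSidedIdeal.square_mono (inf_le_inf h1 k1), TwoSidedIdeal.square_mono (inf_le_inf h2 k2), ?_⟩
  intro x hx
  have hx' := TwoSidedIdeal.square_le _ hx
  have hf : q.f x ∈ J ⊓ K := q.f_mem_of_mem_square (inf_le_right.trans k1) hx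
  have hg : p.g x ∈ J ⊓ K := p.g_mem_of_mem_square (inf_le_left.trans h1) hx
  constructor
  · change p.f (q.f x) = p'.f (q'.f x)
    rw [← (k x hx'.2).1, (h _ hf.1).1]
  · change q.g (p.g x) = q'.g (p'.g x)
    rw [← (h x hx'.1).2, (k _ hg.2).2]

/-- Triples whose maps agree on the intersection of the domains are identified. -/
theorem rel_of_forall {p q : SymPair R}
    (h : ∀ x ∈ p.I ⊓ q.I, p.f x = q.f x ∧ p.g x = q.g x) : Rel p q :=
  ⟨p.I ⊓ q.I, TwoSidedIdeal.inf_ne_bot p.ne_bot q.ne_bot, inf_le_left, inf_le_right, h⟩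

end SymPair

/-- The Martindale symmetric ring of quotients `Q_s(R)` of a prime ring `R`. -/
def SymQuot (R : Type*) [NonUnitalRing R] [IsPrimeRing R] : Type _ :=
  Quotient (SymPair.setoid R)

namespace SymQuot

variable {R : Type*} [NonUnitalRing R] [IsPrimeRing R]

/-- The class of a triple. -/
def mk (p : SymPair R) : SymQuot R := Quotient.mk _ p

theorem sound {p q : SymPair R}
    (h : ∀ x ∈ p.I ⊓ q.I, p.f x = q.f x ∧ p.g x = q.g x) : mk p = mk q :=
  Quotient.sound (SymPair.rel_of_forall h)

instance : Zero (SymQuot R) := ⟨mk (SymPair.ofElem 0)⟩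
instance : One (SymQuot R) := ⟨mk SymPair.one⟩
instance : Add (SymQuot R) :=
  ⟨Quotient.map₂ SymPair.add fun _ _ hp _ _ hq => SymPair.add_congr hp hq⟩
instance : Neg (SymQuot R) := ⟨Quotient.map SymPair.neg fun _ _ hp => SymPair.neg_congr hp⟩
instance : Mul (SymQuot R) :=
  ⟨Quotient.map₂ SymPair.mul fun _ _ hp _ _ hq => SymPair.mul_congr hp hq⟩

instance : Ring (SymQuot R) where
  add_assoc := by
    rintro ⟨p⟩ ⟨q⟩ ⟨r⟩
    exact sound fun x _ => ⟨add_assoc _ _ _, add_assoc _ _ _⟩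
  zero_add := by
    rintro ⟨p⟩
    refine sound fun x _ => ⟨?_, ?_⟩
    · change 0 * x + p.f x = p.f x
      rw [zero_mul, zero_add]
    · change x * 0 + p.g x = p.g x
      rw [mul_zero, zero_add]
  add_zero := by
    rintro ⟨p⟩
    refine sound fun x _ => ⟨?_, ?_⟩
    · change p.f x + 0 * x = p.f x
      rw [zero_mul, add_zero]
    · change p.g x + x * 0 = p.g x
      rw [mul_zero, add_zero]
  add_comm := by
    rintro ⟨p⟩ ⟨q⟩
    exact sound fun x _ => ⟨add_comm _ _, add_comm _ _⟩
  neg_add_cancel := by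
    rintro ⟨p⟩
    refine sound fun x _ => ⟨?_, ?_⟩
    · change -p.f x + p.f x = 0 * x
      rw [zero_mul, neg_add_cancel]
    · change -p.g x + p.g x = x * 0
      rw [mul_zero, neg_add_cancel]
  mul_assoc := by
    rintro ⟨p⟩ ⟨q⟩ ⟨r⟩
    exact sound fun x _ => ⟨rfl, rfl⟩
  one_mul := by
    rintro ⟨p⟩
    exact sound fun x _ => ⟨rfl, rfl⟩
  mul_one := by
    rintro ⟨p⟩
    exact sound fun x _ => ⟨rfl, rfl⟩
  zero_mul := by
    rintro ⟨p⟩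
    refine sound fun x _ => ⟨?_, ?_⟩
    · change 0 * p.f x = 0 * x
      rw [zero_mul, zero_mul]
    · change p.g (x * 0) = x * 0
      rw [mul_zero, p.g_zero]
  mul_zero := by
    rintro ⟨p⟩
    refine sound fun x _ => ⟨?_, ?_⟩
    · change p.f (0 * x) = 0 * x
      rw [zero_mul, p.f_zero]
    · change p.g x * 0 = x * 0
      rw [mul_zero, mul_zero]
  left_distrib := by
    rintro ⟨p⟩ ⟨q⟩ ⟨r⟩
    refine sound fun x hx => ?_
    have h1 : x ∈ (p.I ⊓ q.I).square := hx.2.1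
    have h2 : x ∈ (p.I ⊓ r.I).square := hx.2.2
    refine ⟨p.f_add _ (q.f_mem_of_mem_square inf_le_right h1).1 _
      (r.f_mem_of_mem_square inf_le_right h2).1, rfl⟩
  right_distrib := by
    rintro ⟨p⟩ ⟨q⟩ ⟨r⟩
    refine sound fun x hx => ?_
    have h1 : x ∈ (p.I ⊓ r.I).square := hx.2.1
    have h2 : x ∈ (q.I ⊓ r.I).square := hx.2.2
    refine ⟨rfl, r.g_add _ (p.g_mem_of_mem_square inf_le_left h1).2 _
      (q.g_mem_of_mem_square inf_le_left h2).2⟩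
  nsmul := nsmulRec
  zsmul := zsmulRec

/-- The canonical embedding `R → Q_s(R)`, sending `a` to the class of the pair of left and right
multiplications by `a`. -/
def ofRing (R : Type*) [NonUnitalRing R] [IsPrimeRing R] : R →ₙ+* SymQuot R where
  toFun a := mk (SymPair.ofElem a)
  map_zero' := rfl
  map_add' _ _ := sound fun _ _ => ⟨add_mul _ _ _, mul_add _ _ _⟩
  map_mul' _ _ := sound fun _ _ => ⟨mul_assoc _ _ _, (mul_assoc _ _ _).symm⟩

end SymQuot

/-- The extended centroid `C` of a prime ring `R`: the center of `Q_s(R)`. -/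
def extendedCentroid (R : Type*) [NonUnitalRing R] [IsPrimeRing R] : Subring (SymQuot R) :=
  Subring.center (SymQuot R)

/-- `AC`, for an additive subgroup `A` of `R`: the additive subgroup of `Q_s(R)` generated by all
`a c` with `a ∈ A` and `c ∈ C`. -/
def mulCentroid {R : Type*} [NonUnitalRing R] [IsPrimeRing R] (A : AddSubgroup R) :
    AddSubgroup (SymQuot R) :=
  AddSubgroup.closure {q | ∃ a ∈ A, ∃ c ∈ extendedCentroid R, q = SymQuot.ofRing R a * c}

/-- `RC`, the central closure of `R` (as an additive subgroup of `Q_s(R)`). -/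
def centralClosure (R : Type*) [NonUnitalRing R] [IsPrimeRing R] : AddSubgroup (SymQuot R) :=
  mulCentroid (⊤ : AddSubgroup R)

/-- `Cb + C`, the set of all `c b + d` with `c, d ∈ C`, as a subset of `Q_s(R)`. -/
def centroidSpanOne {R : Type*} [NonUnitalRing R] [IsPrimeRing R] (b : R) : Set (SymQuot R) :=
  {q | ∃ c ∈ extendedCentroid R, ∃ d ∈ extendedCentroid R, q = c * SymQuot.ofRing R b + d}

/-- `[A, B]`: the additive subgroup generated by all `ab - ba` with `a ∈ A` and `b ∈ B`. -/
def commutatorSpan {S : Type*} [NonUnitalRing S] (A B : AddSubgroup S) : AddSubgroup S :=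
  AddSubgroup.closure {s | ∃ a ∈ A, ∃ b ∈ B, s = a * b - b * a}

/-- `u` is a unit of the ring `RC`: it lies in `RC` and has an inverse in `RC`.  (If there is such
a `v`, then `1 = uv` lies in `RC`; conversely, an identity element of `RC` is the identity of
`Q_s(R)`.) -/
def IsUnitOfCentralClosure {R : Type*} [NonUnitalRing R] [IsPrimeRing R] (u : SymQuot R) : Prop :=
  u ∈ centralClosure R ∧ ∃ v ∈ centralClosure R, u * v = 1 ∧ v * u = 1

/-! ### Lie ideals -/

/-- A Lie ideal of an associative ring: an additive subgroup `L` with `[L, R] ⊆ L`. -/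
def IsLieIdeal {R : Type*} [NonUnitalRing R] (L : AddSubgroup R) : Prop :=
  ∀ x ∈ L, ∀ r : R, x * r - r * x ∈ L

/-- `L` is abelian: `[L, L] = 0`. -/
def IsAbelianLie {R : Type*} [NonUnitalRing R] (L : AddSubgroup R) : Prop :=
  ∀ x ∈ L, ∀ y ∈ L, x * y - y * x = 0

/-- `L` is central: `L ⊆ Z(R)`. -/
def IsCentralLie {R : Type*} [NonUnitalRing R] (L : AddSubgroup R) : Prop :=
  ∀ x ∈ L, x ∈ NonUnitalSubring.center R

/-- `L + aL`. -/
def addMulLeft {R : Type*} [NonUnitalRing R] (L : AddSubgroup R) (a : R) : AddSubgroup R :=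
  L ⊔ L.map (AddMonoidHom.mulLeft a)

/-- The additive subgroup `A` contains a nonzero (two-sided) ideal of `R`. -/
def ContainsNonzeroIdeal {R : Type*} [NonUnitalRing R] (A : AddSubgroup R) : Prop :=
  ∃ I : TwoSidedIdeal R, I ≠ ⊥ ∧ ∀ x ∈ I, x ∈ A

/-! If `L` is not abelian, the set of `x` with `[x, R] ⊆ L` contains a nonzero ideal `I`, because it
contains `[L, L]` together with all its multiples. For `z ∈ I` the identity `[a, t] z = [az, t] -
a[z, t]` puts `[a, t] I` inside `L + aL`; for noncentral `a`, primeness then gives a nonzero ideal.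

If `L` is abelian, expanding `[x, [y, ts]] = 0` shows that the inner derivations of two elements of
`L` are proportional, up to sign, in the sense of Martindale's lemma. This forces characteristic
two, central squares on `L`, and `L ⊆ Cb + C` for any noncentral `b ∈ L`.

The abelian case rests on one criterion, `IsAbelianLie.containsNonzeroIdeal_iff`: `L + aL` contains
a nonzero ideal exactly when `[a, b]² ≠ 0`. It needs elements `x` of any nonzero ideal with `[b, x]²
≠ 0`. These also show that the centralizer of `b` in `R` lies in `LC`, since `[b, x]²` is invertible
in `C`. The three subcases become statements about `[a, b]`: it is zero when `a ∈ LC`; it is in `C`,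
and nonzero unless `a ∈ LC`, when `a ∈ [RC, RC]`; in general its square is central, so it is a unit
of `RC` exactly when the square is nonzero. -/

/-! ### Prime rings and nonzero ideals -/

section PrimeRing

variable {R : Type*} [NonUnitalRing R]

/-- The largest ideal contained in the additive subgroup `A`. -/
def AddSubgroup.idealCore (A : AddSubgroup R) : TwoSidedIdeal R :=
  TwoSidedIdeal.mk' {x : R | x ∈ A ∧ (∀ r, r * x ∈ A) ∧ (∀ s, x * s ∈ A) ∧ ∀ r s, r * x * s ∈ A}
    ⟨A.zero_mem, fun r => by simp, fun s => by simp, fun r s => by simp⟩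
    (fun {x y} hx hy => ⟨A.add_mem hx.1 hy.1,
      fun r => by rw [mul_add]; exact A.add_mem (hx.2.1 r) (hy.2.1 r),
      fun s => by rw [add_mul]; exact A.add_mem (hx.2.2.1 s) (hy.2.2.1 s),
      fun r s => by rw [mul_add, add_mul]; exact A.add_mem (hx.2.2.2 r s) (hy.2.2.2 r s)⟩)
    (fun {x} hx => ⟨A.neg_mem hx.1,
      fun r => by rw [mul_neg]; exact A.neg_mem (hx.2.1 r),
      fun s => by rw [neg_mul]; exact A.neg_mem (hx.2.2.1 s),
      fun r s => by rw [mul_neg, neg_mul]; exact A.neg_mem (hx.2.2.2 r s)⟩)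
    (fun {x y} hy => ⟨hy.2.1 x, fun r => by rw [← mul_assoc]; exact hy.2.1 _,
      fun s => hy.2.2.2 x s, fun r s => by rw [← mul_assoc]; exact hy.2.2.2 _ s⟩)
    (fun {y x} hy => ⟨hy.2.2.1 x, fun r => by rw [← mul_assoc]; exact hy.2.2.2 r x,
      fun s => by rw [mul_assoc]; exact hy.2.2.1 _,
      fun r s => by rw [← mul_assoc, mul_assoc]; exact hy.2.2.2 r _⟩)

theorem AddSubgroup.mem_idealCore {A : AddSubgroup R} {x : R} :
    x ∈ A.idealCore ↔
      x ∈ A ∧ (∀ r, r * x ∈ A) ∧ (∀ s, x * s ∈ A) ∧ ∀ r s, r * x * s ∈ A := by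
  simp [AddSubgroup.idealCore]

theorem mem_center_of_forall_commute {a : R} (h : ∀ r, a * r = r * a) :
    a ∈ NonUnitalSubring.center R :=
  NonUnitalSubring.mem_center_iff.2 fun r => (h r).symm

theorem exists_commutator_ne_zero {a : R} (h : a ∉ NonUnitalSubring.center R) :
    ∃ r, a * r - r * a ≠ 0 := by
  by_contra! h'
  exact h (mem_center_of_forall_commute fun r => sub_eq_zero.1 (h' r))

variable [IsPrimeRing R]

theorem IsPrimeRing.eq_zero_right {a b : R} (ha : a ≠ 0) (h : ∀ r : R, a * r * b = 0) : b = 0 :=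
  (IsPrimeRing.eq_zero_or_eq_zero a b h).resolve_left ha

theorem IsPrimeRing.eq_zero_left {a b : R} (hb : b ≠ 0) (h : ∀ r : R, a * r * b = 0) : a = 0 :=
  (IsPrimeRing.eq_zero_or_eq_zero a b h).resolve_right hb

theorem IsPrimeRing.eq_zero_of_forall_mul_eq_zero {I : TwoSidedIdeal R} (hI : I ≠ ⊥) {a : R}
    (h : ∀ x ∈ I, a * x = 0) : a = 0 := by
  obtain ⟨x, hx, hx0⟩ := TwoSidedIdeal.exists_ne_zero_of_ne_bot hI
  exact IsPrimeRing.eq_zero_left hx0 fun r => by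
    rw [mul_assoc]; exact h _ (I.mul_mem_left _ _ hx)

theorem IsPrimeRing.eq_zero_of_mul_self_mem_center {u : R} (hu : u ∈ NonUnitalSubring.center R)
    (h : u * u = 0) : u = 0 := by
  have hu := NonUnitalSubring.mem_center_iff.1 hu
  exact or_self_iff.1 (IsPrimeRing.eq_zero_or_eq_zero u u fun r => by
    rw [← hu r, mul_assoc, h, mul_zero])

theorem IsPrimeRing.mul_ne_zero_of_mem_center {u x : R} (hu : u ∈ NonUnitalSubring.center R)
    (hu0 : u ≠ 0) (hx : x ≠ 0) : u * x ≠ 0 := by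
  have hu := NonUnitalSubring.mem_center_iff.1 hu
  intro h
  exact hx (IsPrimeRing.eq_zero_right hu0 fun r => by
    rw [← hu r, mul_assoc, h, mul_zero])

/-- A subgroup that contains `yR` for a nonzero central `y` contains a nonzero ideal. -/
theorem containsNonzeroIdeal_of_center_mul {A : AddSubgroup R} {y : R}
    (hy : y ∈ NonUnitalSubring.center R) (hy0 : y ≠ 0) (h : ∀ r, y * r ∈ A) :
    ContainsNonzeroIdeal A := by
  have hy' := NonUnitalSubring.mem_center_iff.1 hy
  refine ⟨A.idealCore, ?_, fun x hx => (AddSubgroup.mem_idealCore.1 hx).1⟩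
  -- Without a unit, `y` itself need not lie in `A`, but `y * y` does. Centrality rewrites each
  -- multiple of it as `y` times something.
  refine TwoSidedIdeal.ne_bot_of_mem (a := y * y) (AddSubgroup.mem_idealCore.2 ⟨h y, ?_, ?_, ?_⟩)
    (IsPrimeRing.mul_ne_zero_of_mem_center hy hy0 hy0)
  · intro r; rw [← mul_assoc, hy']; exact h _
  · intro s; rw [mul_assoc]; exact h _
  · intro r s; rw [← mul_assoc, hy', mul_assoc, mul_assoc]; exact h _

end PrimeRing

/-! ### Lie ideals that are not abelian -/

section NonAbelian

variable {R : Type*} [NonUnitalRing R]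

/-- The subgroup `{x | [x, R] ⊆ L}`. -/
def lieTransporter (L : AddSubgroup R) : AddSubgroup R where
  carrier := {x | ∀ r, x * r - r * x ∈ L}
  zero_mem' := fun r => by simp
  add_mem' := fun {x y} hx hy r => by
    rw [add_mul, mul_add, add_sub_add_comm]; exact L.add_mem (hx r) (hy r)
  neg_mem' := fun {x} hx r => by
    rw [neg_mul, mul_neg, ← neg_sub']; exact L.neg_mem (hx r)

variable {L : AddSubgroup R}

theorem IsLieIdeal.commutator_mem' (hL : IsLieIdeal L) {x : R} (hx : x ∈ L) (r : R) :
    r * x - x * r ∈ L := by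
  rw [← neg_sub]; exact L.neg_mem (hL x hx r)

/-- Rests on `[xy, r] = [x, yr] + [y, rx]`. -/
theorem IsLieIdeal.mul_mem_lieTransporter (hL : IsLieIdeal L) {x y : R} (hx : x ∈ L)
    (hy : y ∈ L) : x * y ∈ lieTransporter L := fun r => by
  have : x * y * r - r * (x * y) = (x * (y * r) - (y * r) * x) + (y * (r * x) - (r * x) * y) := by
    simp only [mul_assoc]; abel
  rw [this]
  exact L.add_mem (hL x hx _) (hL y hy _)

/-- Right multiples are handled by `[x, y] r = [x, yr] - y [x, r]`, an element of `L` minus a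
product of two. Left multiples differ from right ones by commutators, which stay in the transporter.
-/
theorem IsLieIdeal.mem_idealCore_of_commutator (hL : IsLieIdeal L) {x y : R} (hx : x ∈ L)
    (hy : y ∈ L) : x * y - y * x ∈ (lieTransporter L).idealCore := by
  have hle : ∀ z ∈ L, z ∈ lieTransporter L := fun z hz => hL z hz
  have right : ∀ r, (x * y - y * x) * r ∈ lieTransporter L := fun r => by
    have : (x * y - y * x) * r = (x * (y * r) - (y * r) * x) - y * (x * r - r * x) := by
      simp only [mul_sub, sub_mul, mul_assoc]; abel
    rw [this]
    exact AddSubgroup.sub_mem _ (hle _ (hL x hx _)) (hL.mul_mem_lieTransporter hy (hL x hx _))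
  have comm : ∀ z ∈ lieTransporter L, ∀ r, r * z - z * r ∈ lieTransporter L := fun z hz r => by
    rw [← neg_sub]; exact AddSubgroup.neg_mem _ (hle _ (hz r))
  refine AddSubgroup.mem_idealCore.2 ⟨hle _ (hL x hx y), fun r => ?_, right, fun r s => ?_⟩
  · have := AddSubgroup.add_mem _ (comm _ (hle _ (hL x hx y)) r) (right r)
    simpa using this
  · have := AddSubgroup.add_mem _ (comm _ (right s) r) (right (s * r))
    simpa [mul_assoc] using this

theorem mem_addMulLeft_of_left {a x : R} (hx : x ∈ L) : x ∈ addMulLeft L a :=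
  AddSubgroup.mem_sup_left hx

theorem mul_mem_addMulLeft {a x : R} (hx : x ∈ L) : a * x ∈ addMulLeft L a :=
  AddSubgroup.mem_sup_right ⟨x, hx, rfl⟩

theorem mem_addMulLeft {a x : R} :
    x ∈ addMulLeft L a ↔ ∃ y ∈ L, ∃ z ∈ L, y + a * z = x := by
  simp [addMulLeft, AddSubgroup.mem_sup]

variable [IsPrimeRing R]

theorem IsLieIdeal.containsNonzeroIdeal_of_not_isAbelianLie (hL : IsLieIdeal L)
    (hab : ¬ IsAbelianLie L) {a : R} (ha : a ∉ NonUnitalSubring.center R) :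
    ContainsNonzeroIdeal (addMulLeft L a) := by
  simp only [IsAbelianLie, not_forall] at hab
  obtain ⟨x, hx, y, hy, hxy⟩ := hab
  set I := (lieTransporter L).idealCore
  have hIL : ∀ z ∈ I, ∀ r, z * r - r * z ∈ L := fun z hz =>
    (AddSubgroup.mem_idealCore.1 hz).1
  have hI : x * y - y * x ∈ I := hL.mem_idealCore_of_commutator hx hy
  obtain ⟨t, ht⟩ := exists_commutator_ne_zero ha
  set v := x * y - y * x
  have right : ∀ z ∈ I, (a * t - t * a) * z ∈ addMulLeft L a := fun z hz => by
    have : (a * t - t * a) * z = (a * z * t - t * (a * z)) + a * -(z * t - t * z) := by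
      simp only [mul_sub, sub_mul, mul_assoc, mul_neg]; abel
    rw [this]
    exact AddSubgroup.add_mem _ (mem_addMulLeft_of_left (hIL _ (I.mul_mem_left _ _ hz) t))
      (mul_mem_addMulLeft (L.neg_mem (hIL z hz t)))
  -- Since `[a, t] z` is again in `I`, its commutators lie in `L`, so left multiples reduce to right
  -- ones.
  have left : ∀ z ∈ I, ∀ r, r * ((a * t - t * a) * z) ∈ addMulLeft L a := fun z hz r => by
    have h1 := mem_addMulLeft_of_left (a := a) (hIL _ (I.mul_mem_left (a * t - t * a) _ hz) r)
    have := AddSubgroup.sub_mem _ (right _ (I.mul_mem_right _ r hz)) h1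
    simpa [mul_assoc] using this
  obtain ⟨r, hr⟩ : ∃ r, (a * t - t * a) * r * v ≠ 0 := by
    by_contra! h
    exact hxy (IsPrimeRing.eq_zero_right ht h)
  have hrv : r * v ∈ I := I.mul_mem_left _ _ hI
  rw [mul_assoc] at hr
  refine ⟨(addMulLeft L a).idealCore, TwoSidedIdeal.ne_bot_of_mem
    (AddSubgroup.mem_idealCore.2 ⟨right _ hrv, left _ hrv, fun s => ?_, fun q s => ?_⟩) hr,
    fun z hz => (AddSubgroup.mem_idealCore.1 hz).1⟩
  · rw [mul_assoc]; exact right _ (I.mul_mem_right _ s hrv)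
  · rw [mul_assoc q, mul_assoc (a * t - t * a)]; exact left _ (I.mul_mem_right _ s hrv) q

end NonAbelian

/-! ### The extended centroid -/

namespace SymQuot

variable {R : Type*} [NonUnitalRing R] [IsPrimeRing R]

theorem mk_mul_ofRing (p : SymPair R) {x : R} (hx : x ∈ p.I) :
    mk p * ofRing R x = ofRing R (p.f x) := by
  refine sound fun y hy => ⟨?_, ?_⟩
  · exact p.f_mul x hx y
  · have hy' : y ∈ p.I := (TwoSidedIdeal.square_le _ hy.1).1
    exact (p.compat y hy' x hx).symm

/-- The vanishing of `f` on `J` kills `g` there, since `g x * y = x * f y = 0` and a nonzero ideal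
has zero left annihilator. -/
theorem mk_eq_zero_of_forall {p : SymPair R} {J : TwoSidedIdeal R} (hJ : J ≠ ⊥) (hJp : J ≤ p.I)
    (h : ∀ x ∈ J, p.f x = 0) : mk p = 0 := by
  refine Quotient.sound ⟨J, hJ, hJp, fun x _ => TwoSidedIdeal.mem_top R, fun x hx => ⟨?_, ?_⟩⟩
  · change p.f x = 0 * x
    rw [h x hx, zero_mul]
  · change p.g x = x * 0
    rw [mul_zero]
    exact IsPrimeRing.eq_zero_of_forall_mul_eq_zero hJ fun y hy => by
      rw [← p.compat x (hJp hx) y (hJp hy), h y hy, mul_zero]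

theorem ofRing_injective : Function.Injective (ofRing R) := by
  rw [injective_iff_map_eq_zero]
  intro a ha
  obtain ⟨J, hJ, -, -, h⟩ := Quotient.exact ha
  refine IsPrimeRing.eq_zero_of_forall_mul_eq_zero hJ fun x hx => ?_
  have : a * x = 0 * x := (h x hx).1
  rw [this, zero_mul]

/-- Every element of `Q_s(R)` maps some nonzero ideal of `R` into `R`. -/
theorem exists_ideal_mul_mem (q : SymQuot R) :
    ∃ I : TwoSidedIdeal R, I ≠ ⊥ ∧ ∀ x ∈ I, ∃ y, q * ofRing R x = ofRing R y := by
  obtain ⟨p, rfl⟩ : ∃ p, mk p = q := Quotient.exists_rep q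
  exact ⟨p.I, p.ne_bot, fun x hx => ⟨p.f x, mk_mul_ofRing p hx⟩⟩

theorem eq_zero_of_forall_mul_ofRing {q : SymQuot R} {J : TwoSidedIdeal R} (hJ : J ≠ ⊥)
    (h : ∀ x ∈ J, q * ofRing R x = 0) : q = 0 := by
  obtain ⟨p, rfl⟩ : ∃ p, mk p = q := Quotient.exists_rep q
  refine mk_eq_zero_of_forall (TwoSidedIdeal.inf_ne_bot hJ p.ne_bot) inf_le_right fun x hx => ?_
  apply ofRing_injective
  rw [← mk_mul_ofRing p hx.2, h x hx.1, map_zero]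

/-- The centralizer of `R` in `Q_s(R)` is the extended centroid. -/
theorem mem_extendedCentroid {q : SymQuot R} :
    q ∈ extendedCentroid R ↔ ∀ r, ofRing R r * q = q * ofRing R r := by
  refine ⟨fun h r => Subring.mem_center_iff.1 h _, fun h => Subring.mem_center_iff.2 fun p => ?_⟩
  obtain ⟨I, hI, hp⟩ := exists_ideal_mul_mem p
  rw [← sub_eq_zero]
  refine eq_zero_of_forall_mul_ofRing hI fun x hx => ?_
  obtain ⟨y, hy⟩ := hp x hx
  rw [sub_mul, mul_assoc, ← h, ← mul_assoc, hy, mul_assoc, hy, h, sub_self]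

theorem ofRing_mem_extendedCentroid {z : R} :
    ofRing R z ∈ extendedCentroid R ↔ z ∈ NonUnitalSubring.center R := by
  rw [mem_extendedCentroid, NonUnitalSubring.mem_center_iff]
  exact forall_congr' fun r => by rw [← map_mul, ← map_mul, ofRing_injective.eq_iff]

/-- Martindale's lemma: families `p`, `q` in `R` with `p i u q j = q i u p j` for all `u` are
proportional over the extended centroid. -/
theorem exists_mem_extendedCentroid_mul {κ : Type*} (p q : κ → R)
    (h : ∀ i j u, p i * u * q j = q i * u * p j) (hq : ∃ i, q i ≠ 0) :
    ∃ c ∈ extendedCentroid R, ∀ i, ofRing R (p i) = c * ofRing R (q i) := by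
  classical
  obtain ⟨k, hk⟩ := hq
  -- If `p i = c q i`, then `P x x'` forces `x' = c x`: the relation is the graph of the multiplier
  -- to be built.
  let P : R → R → Prop := fun x x' => ∀ i u, p i * u * x = q i * u * x'
  have uniq : ∀ {x x' x''}, P x x' → P x x'' → x' = x'' := fun {x x' x''} h1 h2 => by
    rw [← sub_eq_zero]
    exact IsPrimeRing.eq_zero_right hk fun r => by
      rw [mul_sub, ← h1 k r, ← h2 k r, sub_self]
  have hadd : ∀ {x x' y y'}, P x x' → P y y' → P (x + y) (x' + y') := fun h1 h2 i u => by
    rw [mul_add, mul_add, h1, h2]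
  have hneg : ∀ {x x'}, P x x' → P (-x) (-x') := fun h1 i u => by
    rw [mul_neg, mul_neg, h1]
  have hleft : ∀ {x x'} r, P x x' → P (r * x) (r * x') := fun r h1 i u => by
    rw [← mul_assoc, ← mul_assoc, mul_assoc _ u r, mul_assoc _ u r, h1]
  have hright : ∀ {x x'} r, P x x' → P (x * r) (x' * r) := fun r h1 i u => by
    rw [← mul_assoc, ← mul_assoc, h1]
  let I : TwoSidedIdeal R := TwoSidedIdeal.mk' {x | ∃ x', P x x'}
    ⟨0, fun i u => by simp⟩ (fun ⟨x', h1⟩ ⟨y', h2⟩ => ⟨x' + y', hadd h1 h2⟩)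
    (fun ⟨x', h1⟩ => ⟨-x', hneg h1⟩) (fun ⟨x', h1⟩ => ⟨_, hleft _ h1⟩)
    (fun ⟨x', h1⟩ => ⟨_, hright _ h1⟩)
  have hI : ∀ {x}, x ∈ I ↔ ∃ x', P x x' := by simp [I]
  -- The value 0 off `I` is never seen by the quotient.
  let f : R → R := fun x => if hx : ∃ x', P x x' then hx.choose else 0
  have hf : ∀ {x x'}, P x x' → f x = x' := fun {x x'} hx => by
    have hx' : ∃ x', P x x' := ⟨x', hx⟩
    have : f x = hx'.choose := dif_pos hx'
    rw [this]
    exact uniq hx'.choose_spec hx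
  -- This is the hypothesis itself: the multiplier sends `q i` to `p i`, and `I` is nonzero because
  -- it contains `q k`.
  have hqI : ∀ i, P (q i) (p i) := fun i j u => h j i u
  let s : SymPair R :=
    { I := I
      ne_bot := TwoSidedIdeal.ne_bot_of_mem (hI.2 ⟨_, hqI k⟩) hk
      f := f
      g := f
      f_add := fun x hx y hy => by
        obtain ⟨x', hx⟩ := hI.1 hx
        obtain ⟨y', hy⟩ := hI.1 hy
        rw [hf hx, hf hy, hf (hadd hx hy)]
      f_mul := fun x hx r => by
        obtain ⟨x', hx⟩ := hI.1 hx
        rw [hf hx, hf (hright r hx)]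
      g_add := fun x hx y hy => by
        obtain ⟨x', hx⟩ := hI.1 hx
        obtain ⟨y', hy⟩ := hI.1 hy
        rw [hf hx, hf hy, hf (hadd hx hy)]
      g_mul := fun x hx r => by
        obtain ⟨x', hx⟩ := hI.1 hx
        rw [hf hx, hf (hleft r hx)]
      compat := fun x hx y hy => by
        obtain ⟨x', hx⟩ := hI.1 hx
        obtain ⟨y', hy⟩ := hI.1 hy
        rw [hf hx, hf hy, ← hf (hleft x hy), ← hf (hright y hx)] }
  refine ⟨mk s, mem_extendedCentroid.2 fun r => ?_, fun i => ?_⟩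
  · rw [← sub_eq_zero]
    refine eq_zero_of_forall_mul_ofRing s.ne_bot fun x hx => ?_
    obtain ⟨x', hx'⟩ := hI.1 hx
    rw [sub_mul, mul_assoc, mul_assoc, mk_mul_ofRing s hx, ← map_mul, ← map_mul,
      mk_mul_ofRing s (s.I.mul_mem_left _ _ hx), sub_eq_zero]
    change ofRing R (r * f x) = ofRing R (f (r * x))
    rw [hf hx', hf (hleft r hx')]
  · rw [mk_mul_ofRing s (hI.2 ⟨_, hqI i⟩)]
    exact congrArg _ (hf (hqI i)).symm

/-- Nonzero elements of the extended centroid are invertible in it. -/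
theorem exists_inverse_of_mem_extendedCentroid {c : SymQuot R} (hc : c ∈ extendedCentroid R)
    (hc0 : c ≠ 0) : ∃ e ∈ extendedCentroid R, c * e = 1 := by
  obtain ⟨I, hI, hcI⟩ := exists_ideal_mul_mem c
  choose! f hf using hcI
  have hc' := Subring.mem_center_iff.1 hc
  -- For the families `x` and `c x`, with `x ∈ I`, the factor `e` satisfies `x = e c x`.
  obtain ⟨e, he, h⟩ := exists_mem_extendedCentroid_mul (κ := I) (fun x => (x : R))
    (fun x => f x) (fun x y u => ofRing_injective (by
      simp only [map_mul, ← hf _ x.2, ← hf _ y.2]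
      rw [← mul_assoc, hc']
      simp only [mul_assoc])) (by
      by_contra! h
      exact hc0 (eq_zero_of_forall_mul_ofRing hI fun x hx => by
        rw [hf x hx, h ⟨x, hx⟩, map_zero]))
  refine ⟨e, he, ?_⟩
  rw [← sub_eq_zero]
  refine eq_zero_of_forall_mul_ofRing hI fun x hx => ?_
  have h1 := h ⟨x, hx⟩
  simp only [← hf x hx] at h1
  rw [sub_mul, one_mul, sub_eq_zero, Subring.mem_center_iff.1 he, mul_assoc, ← h1]

theorem eq_zero_of_mul_self_eq_zero {c : SymQuot R} (hc : c ∈ extendedCentroid R)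
    (h : c * c = 0) : c = 0 := by
  by_contra hc0
  obtain ⟨e, -, he⟩ := exists_inverse_of_mem_extendedCentroid hc hc0
  apply hc0
  calc c = c * (c * e) := by rw [he, mul_one]
    _ = 0 := by rw [← mul_assoc, h, zero_mul]

end SymQuot

/-! ### Abelian Lie ideals -/

section Abelian

variable {R : Type*} [NonUnitalRing R] {L : AddSubgroup R}

theorem IsAbelianLie.mul_comm (hab : IsAbelianLie L) {x y : R} (hx : x ∈ L) (hy : y ∈ L) :
    x * y = y * x :=
  sub_eq_zero.1 (hab x hx y hy)

/-- Expanding `[x, [y, ts]] = 0` by the Leibniz rule leaves only the two cross terms. Replacing `t`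
by `tu` then inserts the free middle factor `u`, the form needed for primeness and Martindale's
lemma. -/
theorem IsAbelianLie.commutator_mul_commutator (hab : IsAbelianLie L) (hL : IsLieIdeal L)
    {x y : R} (hx : x ∈ L) (hy : y ∈ L) (t u s : R) :
    (y * t - t * y) * u * (x * s - s * x) = -((x * t - t * x) * u * (y * s - s * y)) := by
  have key : ∀ t s, (y * t - t * y) * (x * s - s * x) + (x * t - t * x) * (y * s - s * y) = 0 := by
    intro t s
    have h1 := hab x hx _ (hL y hy t)
    have h2 := hab x hx _ (hL y hy s)
    have h3 := hab x hx _ (hL y hy (t * s))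
    have : (y * t - t * y) * (x * s - s * x) + (x * t - t * x) * (y * s - s * y) =
        (x * (y * (t * s) - t * s * y) - (y * (t * s) - t * s * y) * x)
        - (x * (y * t - t * y) - (y * t - t * y) * x) * s
        - t * (x * (y * s - s * y) - (y * s - s * y) * x) := by
      simp only [mul_sub, sub_mul, mul_assoc]; abel
    rw [this, h1, h2, h3, zero_mul, mul_zero, sub_zero, sub_zero]
  rw [eq_neg_iff_add_eq_zero]
  have : (y * t - t * y) * u * (x * s - s * x) + (x * t - t * x) * u * (y * s - s * y) =
      ((y * (t * u) - t * u * y) * (x * s - s * x) + (x * (t * u) - t * u * x) * (y * s - s * y))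
      - t * ((y * u - u * y) * (x * s - s * x) + (x * u - u * x) * (y * s - s * y)) := by
    simp only [mul_sub, sub_mul, mul_add, mul_assoc]; abel
  rw [this, key, key, mul_zero, sub_zero]

variable [IsPrimeRing R]

/-- A prime ring with a noncentral abelian Lie ideal has characteristic two. -/
theorem IsAbelianLie.add_self (hab : IsAbelianLie L) (hL : IsLieIdeal L) {b : R} (hb : b ∈ L)
    (hbZ : b ∉ NonUnitalSubring.center R) (x : R) : x + x = 0 := by
  obtain ⟨t, ht⟩ := exists_commutator_ne_zero hbZ
  -- With `x = y = b` the identity says that `[b, t] u [b, t]` is its own negative.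
  have h : (b * t - t * b) + (b * t - t * b) = 0 :=
    IsPrimeRing.eq_zero_right ht fun u => by
      rw [mul_add]
      exact add_eq_zero_iff_eq_neg.2 (hab.commutator_mul_commutator hL hb hb t u t)
  exact IsPrimeRing.eq_zero_right ht fun u => by
    rw [mul_add, ← add_mul, ← add_mul, h, zero_mul, zero_mul]

theorem IsAbelianLie.neg_eq (hab : IsAbelianLie L) (hL : IsLieIdeal L) {b : R} (hb : b ∈ L)
    (hbZ : b ∉ NonUnitalSubring.center R) (x : R) : -x = x :=
  neg_eq_of_add_eq_zero_right (hab.add_self hL hb hbZ x)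

/-- In characteristic two, `[l, [l, r]] = l²r - 2lrl + rl²` is `[l², r]`, and it vanishes because
`[l, r] ∈ L`. -/
theorem IsAbelianLie.mul_self_mem_center (hab : IsAbelianLie L) (hL : IsLieIdeal L) {b : R}
    (hb : b ∈ L) (hbZ : b ∉ NonUnitalSubring.center R) {l : R} (hl : l ∈ L) :
    l * l ∈ NonUnitalSubring.center R := by
  refine mem_center_of_forall_commute fun r => ?_
  have h := hab l hl _ (hL l hl r)
  have h2 := hab.add_self hL hb hbZ (l * (r * l))
  have : l * l * r - r * (l * l) = (l * (l * r - r * l) - (l * r - r * l) * l)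
      + (l * (r * l) + l * (r * l)) - (r * (l * l) + r * (l * l)) := by
    simp only [mul_sub, sub_mul, mul_assoc]; abel
  rw [← sub_eq_zero, this, h, h2, add_zero, hab.add_self hL hb hbZ, sub_zero]

open SymQuot

/-- By Martindale's lemma `[y, t] = c [b, t]` for all `t`, so `y - cb` centralizes `R`. -/
theorem IsAbelianLie.exists_eq_mul_add (hab : IsAbelianLie L) (hL : IsLieIdeal L) {b : R}
    (hb : b ∈ L) (hbZ : b ∉ NonUnitalSubring.center R) {y : R} (hy : y ∈ L) :
    ∃ c ∈ extendedCentroid R, ∃ d ∈ extendedCentroid R, ofRing R y = c * ofRing R b + d := by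
  obtain ⟨c, hc, h⟩ := exists_mem_extendedCentroid_mul (fun t => y * t - t * y)
    (fun t => b * t - t * b) (fun t s u => by
      rw [hab.commutator_mul_commutator hL hb hy, hab.neg_eq hL hb hbZ])
    (exists_commutator_ne_zero hbZ)
  refine ⟨c, hc, ofRing R y - c * ofRing R b, mem_extendedCentroid.2 fun r => ?_, by abel⟩
  have hr := h r
  have hc' := mem_extendedCentroid.1 hc
  simp only [map_sub, map_mul, mul_sub] at hr
  rw [mul_sub, sub_mul, ← mul_assoc (ofRing R r), hc', mul_assoc, mul_assoc, ← sub_eq_zero]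
  rw [← sub_eq_zero, ← neg_eq_zero] at hr
  rw [← hr]
  abel

/-- For `b ∈ L` noncentral, every nonzero ideal contains some `x` with `[b, x]` invertible in the
central closure. -/
theorem IsAbelianLie.exists_mem_commutator_mul_self_ne_zero (hab : IsAbelianLie L)
    (hL : IsLieIdeal L) {b : R} (hb : b ∈ L) (hbZ : b ∉ NonUnitalSubring.center R)
    {I : TwoSidedIdeal R} (hI : I ≠ ⊥) :
    ∃ x ∈ I, (b * x - x * b) * (b * x - x * b) ≠ 0 := by
  by_contra! hsq
  obtain ⟨t, ht⟩ := exists_commutator_ne_zero hbZ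
  obtain ⟨x, hx, hv⟩ : ∃ x ∈ I, b * x - x * b ≠ 0 := by
    by_contra! h
    refine ht (IsPrimeRing.eq_zero_of_forall_mul_eq_zero hI fun x hx => ?_)
    have : (b * t - t * b) * x = (b * (t * x) - t * x * b) - t * (b * x - x * b) := by
      simp only [mul_sub, sub_mul, mul_assoc]; abel
    rw [this, h x hx, h _ (I.mul_mem_left _ _ hx), mul_zero, sub_zero]
  have hvL : b * x - x * b ∈ L := hL b hb x
  have hvI : b * x - x * b ∈ I := I.sub_mem (I.mul_mem_left _ _ hx) (I.mul_mem_right _ _ hx)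
  have hvv := hsq x hx
  set v := b * x - x * b
  obtain ⟨c, hc, d, hd, hcd⟩ := hab.exists_eq_mul_add hL hb hbZ hvL
  have hc' := Subring.mem_center_iff.1 hc
  have hd' := Subring.mem_center_iff.1 hd
  -- With `v = cb + d` and `w = [b, s] = c₁b + d₁`, the element `c₁v - cw` is free of `b`, hence in
  -- `C`. Its square is zero because `v² = w² = 0` and `vw + wv = 2vw = 0`. So `[v, s] = cw = c₁v`,
  -- whence `v [v, s] = 0`.
  have hvsv : ∀ s ∈ I, v * s * v = 0 := fun s hs => by
    have hwL : b * s - s * b ∈ L := hL b hb s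
    have hww := hsq s hs
    have hvs : ofRing R (v * s - s * v) = c * ofRing R (b * s - s * b) := by
      simp only [map_sub, map_mul, hcd, add_mul, mul_add, mul_sub, hd', ← mul_assoc, hc']
      abel
    set w := b * s - s * b
    have hvw := hab.mul_comm hvL hwL
    obtain ⟨c₁, hc₁, d₁, hd₁, hcd₁⟩ := hab.exists_eq_mul_add hL hb hbZ hwL
    have hc₁' := Subring.mem_center_iff.1 hc₁
    have hdiff : c₁ * ofRing R v - c * ofRing R w ∈ extendedCentroid R := by
      have : c₁ * ofRing R v - c * ofRing R w = c₁ * d - c * d₁ := by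
        rw [hcd, hcd₁, mul_add, mul_add, ← mul_assoc, ← mul_assoc, hc₁' c]; abel
      rw [this]
      exact sub_mem (mul_mem hc₁ hd) (mul_mem hc hd₁)
    have hz : c₁ * ofRing R v - c * ofRing R w = 0 := by
      refine eq_zero_of_mul_self_eq_zero hdiff ?_
      have e1 : ofRing R v * ofRing R v = 0 := by rw [← map_mul, hvv, map_zero]
      have e2 : ofRing R w * ofRing R w = 0 := by rw [← map_mul, hww, map_zero]
      have e3 : ofRing R v * ofRing R w + ofRing R w * ofRing R v = 0 := by
        rw [← map_mul, ← map_mul, ← map_add, ← hvw, hab.add_self hL hb hbZ, map_zero]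
      have : (c₁ * ofRing R v - c * ofRing R w) * (c₁ * ofRing R v - c * ofRing R w) =
          c₁ * c₁ * (ofRing R v * ofRing R v) + c * c * (ofRing R w * ofRing R w)
          - c₁ * c * (ofRing R v * ofRing R w + ofRing R w * ofRing R v) := by
        have a1 : ∀ p q : SymQuot R, c₁ * p * (c₁ * q) = c₁ * c₁ * (p * q) := fun p q => by
          rw [mul_assoc, ← mul_assoc p, hc₁' p]; simp only [mul_assoc]
        have a2 : ∀ p q : SymQuot R, c * p * (c * q) = c * c * (p * q) := fun p q => by
          rw [mul_assoc, ← mul_assoc p, hc' p]; simp only [mul_assoc]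
        have a3 : ∀ p q : SymQuot R, c₁ * p * (c * q) = c₁ * c * (p * q) := fun p q => by
          rw [mul_assoc, ← mul_assoc p, hc' p]; simp only [mul_assoc]
        have a4 : ∀ p q : SymQuot R, c * p * (c₁ * q) = c₁ * c * (p * q) := fun p q => by
          rw [mul_assoc, ← mul_assoc p, hc₁' p, ← hc₁' c]; simp only [mul_assoc]
        rw [mul_sub, sub_mul, sub_mul, a1, a2, a3, a4, mul_add]
        abel
      rw [this, e1, e2, e3]
      simp
    have hvvs : v * (v * s - s * v) = 0 := by
      apply ofRing_injective
      rw [map_mul, hvs, ← sub_eq_zero.1 hz, ← mul_assoc, hc₁', mul_assoc, ← map_mul, hvv,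
        map_zero, mul_zero]
    rw [mul_sub, ← mul_assoc, hvv, zero_mul, zero_sub, neg_eq_zero] at hvvs
    rw [mul_assoc, hvvs]
  have : ∀ y ∈ I, v * y = 0 := fun y hy => IsPrimeRing.eq_zero_left hv fun r => by
    rw [mul_assoc v]; exact hvsv _ (I.mul_mem_right _ _ hy)
  exact hv (IsPrimeRing.eq_zero_of_forall_mul_eq_zero hI this)

/-- For `b ∈ L` noncentral, `L + aL` contains a nonzero ideal if and only if `[a, b]² ≠ 0`. -/
theorem IsAbelianLie.containsNonzeroIdeal_iff (hab : IsAbelianLie L) (hL : IsLieIdeal L) {b : R}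
    (hb : b ∈ L) (hbZ : b ∉ NonUnitalSubring.center R) (a : R) :
    ContainsNonzeroIdeal (addMulLeft L a) ↔ (a * b - b * a) * (a * b - b * a) ≠ 0 := by
  constructor
  · rintro ⟨I, hI, hIL⟩
    obtain ⟨x, hx, hz⟩ := hab.exists_mem_commutator_mul_self_ne_zero hL hb hbZ hI
    have hvL : b * x - x * b ∈ L := hL b hb x
    have hzZ := hab.mul_self_mem_center hL hb hbZ hvL
    have hbv := hab.mul_comm hb hvL
    -- Applying `[b, ·]` to `x [b, x] = l + a l'` gives `[b, x]² = [b, a] l'`, as `[b, x]`, `l` and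
    -- `l'` commute with `b`.
    obtain ⟨l, hl, l', hl', h⟩ := mem_addMulLeft.1 (hIL _ (I.mul_mem_right x (b * x - x * b) hx))
    have hbl := hab.mul_comm hb hl
    have hbl' := hab.mul_comm hb hl'
    have huL : b * a - a * b ∈ L := hL b hb a
    have hul := hab.mul_comm huL hl'
    have hzu : (b * x - x * b) * (b * x - x * b) = (b * a - a * b) * l' := by
      have e1 : (b * x - x * b) * (b * x - x * b)
          = b * (x * (b * x - x * b)) - x * (b * x - x * b) * b := by
        conv_lhs => rw [sub_mul, mul_assoc, mul_assoc x b, hbv, ← mul_assoc x]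
      rw [e1, ← h, mul_add, add_mul, hbl, mul_assoc a, ← hbl', sub_mul, mul_assoc, mul_assoc]
      abel
    -- As `[b, a]` and `l'` commute, `[b, x]⁴ = [b, a]² l'²`, so `[b, a]²` cannot vanish.
    have hzz := IsPrimeRing.mul_ne_zero_of_mem_center hzZ hz hz
    rw [hzu] at hzz
    intro h0
    apply hzz
    have h0' : (b * a - a * b) * (b * a - a * b) = 0 := by
      rw [← neg_sub, neg_mul_neg, h0]
    rw [mul_assoc, ← mul_assoc l', ← hul, mul_assoc, ← mul_assoc, h0', zero_mul]
  · intro hu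
    rw [← neg_sub, neg_mul_neg] at hu
    have huL : b * a - a * b ∈ L := hL b hb a
    have hyZ := hab.mul_self_mem_center hL hb hbZ huL
    have hbu := hab.mul_comm hb huL
    have hu_def : b * a = (b * a - a * b) + a * b := by abel
    set u := b * a - a * b
    have hy' := NonUnitalSubring.mem_center_iff.1 hyZ
    have hbL : ∀ k r, b * k = k * b → k * (b * r - r * b) ∈ L := fun k r hk => by
      have : k * (b * r - r * b) = b * (k * r) - k * r * b := by
        rw [← mul_assoc b, hk, mul_sub]; simp only [mul_assoc]
      rw [this]; exact hL b hb _
    -- One factor `u²` gives `u² r = k + a (u w)` with `k` centralizing `b`; the second brings `k`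
    -- and `u w` into `L`.
    refine containsNonzeroIdeal_of_center_mul (y := u * u * (u * u)) (mul_mem hyZ hyZ)
      (IsPrimeRing.mul_ne_zero_of_mem_center hyZ hu hu) fun r => ?_
    have hwL : b * r - r * b ∈ L := hL b hb r
    have hbw := hab.mul_comm hb hwL
    have hw_def : b * r = (b * r - r * b) + r * b := by abel
    set w := b * r - r * b
    -- Chosen so that `[b, k] = u² w - u (u w) = 0`.
    set k := u * u * r - a * (u * w)
    have huw : b * (u * w) = u * w * b := by
      rw [← mul_assoc, hbu, mul_assoc, hbw, mul_assoc]
    have hk : b * k = k * b := by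
      have : b * k - k * b = (b * (u * u) - u * u * b) * r + u * u * w - (u * (u * w))
          - a * (b * (u * w) - u * w * b) := by
        simp only [k, w, u, mul_sub, sub_mul, mul_assoc]; abel
      rw [← sub_eq_zero, this, hy', huw, sub_self, sub_self, zero_mul, mul_zero, mul_assoc u u w]
      abel
    have hyk : u * u * k ∈ L := by
      have h1 := hbL k (a * u) hk
      have : b * (a * u) - a * u * b = u * u := by
        rw [mul_assoc a, ← hbu, ← mul_assoc, ← mul_assoc, ← sub_mul]
      rwa [this, hy'] at h1
    have hyw : u * u * (u * w) ∈ L := by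
      rw [← mul_assoc]
      refine hbL _ r ?_
      rw [← mul_assoc, hy', mul_assoc, hbu, ← mul_assoc]
    have : u * u * (u * u) * r = u * u * k + a * (u * u * (u * w)) := by
      rw [← mul_assoc a, hy' a]
      simp only [k, mul_sub, mul_assoc]
      abel
    rw [this]
    exact AddSubgroup.add_mem _ (mem_addMulLeft_of_left hyk) (mul_mem_addMulLeft hyw)

end Abelian

/-! ### The central closure -/

section CentralClosure

open SymQuot

variable {R : Type*} [NonUnitalRing R] [IsPrimeRing R] {L : AddSubgroup R}

theorem ofRing_mul_mem_mulCentroid {l : R} (hl : l ∈ L) {c : SymQuot R}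
    (hc : c ∈ extendedCentroid R) : ofRing R l * c ∈ mulCentroid L :=
  AddSubgroup.subset_closure ⟨l, hl, c, hc, rfl⟩

theorem mul_mem_mulCentroid {q c : SymQuot R} (hq : q ∈ mulCentroid L)
    (hc : c ∈ extendedCentroid R) : q * c ∈ mulCentroid L := by
  induction hq using AddSubgroup.closure_induction with
  | mem q hq =>
    obtain ⟨l, hl, e, he, rfl⟩ := hq
    rw [mul_assoc]
    exact ofRing_mul_mem_mulCentroid hl (mul_mem he hc)
  | zero => rw [zero_mul]; exact zero_mem _
  | add x y _ _ hx hy => rw [add_mul]; exact add_mem hx hy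
  | neg x _ hx => rw [neg_mul]; exact neg_mem hx

/-- A nonzero central element of `R` is invertible in the extended centroid. -/
theorem exists_inverse_ofRing {z : R} (hz : z ∈ NonUnitalSubring.center R) (hz0 : z ≠ 0) :
    ∃ e ∈ extendedCentroid R, ofRing R z * e = 1 :=
  exists_inverse_of_mem_extendedCentroid (ofRing_mem_extendedCentroid.2 hz)
    ((map_ne_zero_iff _ ofRing_injective).2 hz0)

/-- For `b ∈ L` noncentral, the centralizer of `b` in `R` lies in `LC`. -/
theorem IsAbelianLie.ofRing_mem_mulCentroid_of_commute (hab : IsAbelianLie L) (hL : IsLieIdeal L)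
    {b : R} (hb : b ∈ L) (hbZ : b ∉ NonUnitalSubring.center R) {k : R} (hk : b * k = k * b) :
    ofRing R k ∈ mulCentroid L := by
  obtain ⟨x, -, hz⟩ :=
    hab.exists_mem_commutator_mul_self_ne_zero hL hb hbZ (I := ⊤) TwoSidedIdeal.top_ne_bot'
  have hvL := hL b hb x
  have hbv := hab.mul_comm hb hvL
  obtain ⟨e, he, hze⟩ :=
    exists_inverse_ofRing (hab.mul_self_mem_center hL hb hbZ hvL) hz
  set v := b * x - x * b
  -- Since `k` and `v` commute with `b`, `k v² = [b, k x v]`.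
  have hkv : k * (v * v) ∈ L := by
    have : k * (v * v) = b * (k * (x * v)) - k * (x * v) * b := by
      rw [← mul_assoc b, hk, mul_assoc k, mul_assoc k, ← mul_sub, mul_assoc x, ← hbv,
        ← mul_assoc b, ← mul_assoc x, ← sub_mul]
    rw [this]; exact hL b hb _
  have := ofRing_mul_mem_mulCentroid hkv he
  rwa [map_mul, mul_assoc, hze, mul_one] at this

/-- The extended centroid lies in `LC`. -/
theorem IsAbelianLie.extendedCentroid_subset_mulCentroid (hab : IsAbelianLie L)
    (hL : IsLieIdeal L) {b : R} (hb : b ∈ L) (hbZ : b ∉ NonUnitalSubring.center R)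
    {c : SymQuot R} (hc : c ∈ extendedCentroid R) : c ∈ mulCentroid L := by
  obtain ⟨x, -, hz⟩ :=
    hab.exists_mem_commutator_mul_self_ne_zero hL hb hbZ (I := ⊤) TwoSidedIdeal.top_ne_bot'
  have hzZ := hab.mul_self_mem_center hL hb hbZ (hL b hb x)
  obtain ⟨e, he, hze⟩ := exists_inverse_ofRing hzZ hz
  -- The nonzero central square `[b, x]²` commutes with `b`, so it lies in `LC`; multiplying by its
  -- inverse and `c` gives `c`.
  have h := hab.ofRing_mem_mulCentroid_of_commute hL hb hbZ
    (NonUnitalSubring.mem_center_iff.1 hzZ b)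
  have := mul_mem_mulCentroid h (mul_mem he hc)
  rwa [← mul_assoc, hze, one_mul] at this

theorem IsAbelianLie.mulCentroid_eq_centroidSpanOne (hab : IsAbelianLie L) (hL : IsLieIdeal L)
    {b : R} (hb : b ∈ L) (hbZ : b ∉ NonUnitalSubring.center R) :
    (mulCentroid L : Set (SymQuot R)) = centroidSpanOne b := by
  apply Set.Subset.antisymm
  · intro q hq
    rw [SetLike.mem_coe] at hq
    induction hq using AddSubgroup.closure_induction with
    | mem q hq =>
      obtain ⟨l, hl, e, he, rfl⟩ := hq
      obtain ⟨c, hc, d, hd, h⟩ := hab.exists_eq_mul_add hL hb hbZ hl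
      refine ⟨c * e, mul_mem hc he, d * e, mul_mem hd he, ?_⟩
      rw [h, add_mul, mul_assoc, mul_assoc, Subring.mem_center_iff.1 he]
    | zero => exact ⟨0, zero_mem _, 0, zero_mem _, by simp⟩
    | add x y _ _ hx hy =>
      obtain ⟨c, hc, d, hd, rfl⟩ := hx
      obtain ⟨c', hc', d', hd', rfl⟩ := hy
      exact ⟨c + c', add_mem hc hc', d + d', add_mem hd hd', by rw [add_mul]; abel⟩
    | neg x _ hx =>
      obtain ⟨c, hc, d, hd, rfl⟩ := hx
      exact ⟨-c, neg_mem hc, -d, neg_mem hd, by rw [neg_mul, neg_add]⟩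
  · rintro q ⟨c, hc, d, hd, rfl⟩
    refine add_mem ?_ (hab.extendedCentroid_subset_mulCentroid hL hb hbZ hd)
    rw [← Subring.mem_center_iff.1 hc]
    exact ofRing_mul_mem_mulCentroid hb hc

theorem IsAbelianLie.commutator_eq_zero_of_mem_mulCentroid (hab : IsAbelianLie L) {b : R}
    (hb : b ∈ L) {q : SymQuot R} (hq : q ∈ mulCentroid L) : q * ofRing R b = ofRing R b * q := by
  induction hq using AddSubgroup.closure_induction with
  | mem q hq =>
    obtain ⟨l, hl, e, he, rfl⟩ := hq
    rw [mul_assoc, ← Subring.mem_center_iff.1 he, ← mul_assoc, ← mul_assoc, ← map_mul, ← map_mul,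
      hab.mul_comm hl hb]
  | zero => rw [zero_mul, mul_zero]
  | add x y _ _ hx hy => rw [add_mul, mul_add, hx, hy]
  | neg x _ hx => rw [neg_mul, mul_neg, hx]

/-- For `b ∈ L`, the inner derivation of `b` maps `RC` to `Cb + C`. -/
theorem IsAbelianLie.exists_commutator_eq_mul_add (hab : IsAbelianLie L) (hL : IsLieIdeal L)
    {b : R} (hb : b ∈ L) (hbZ : b ∉ NonUnitalSubring.center R) {q : SymQuot R}
    (hq : q ∈ centralClosure R) :
    ∃ c ∈ extendedCentroid R, ∃ d ∈ extendedCentroid R,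
      ofRing R b * q - q * ofRing R b = c * ofRing R b + d := by
  have : ofRing R b * q - q * ofRing R b ∈ mulCentroid L := by
    unfold centralClosure at hq
    induction hq using AddSubgroup.closure_induction with
    | mem q hq =>
      obtain ⟨l, -, e, he, rfl⟩ := hq
      have := ofRing_mul_mem_mulCentroid (hL b hb l) he
      rwa [map_sub, map_mul, map_mul, sub_mul, mul_assoc, mul_assoc _ _ e,
        Subring.mem_center_iff.1 he (ofRing R b), ← mul_assoc (ofRing R l)] at this
    | zero => rw [zero_mul, mul_zero, sub_zero]; exact zero_mem _
    | add x y _ _ hx hy =>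
      rw [add_mul, mul_add, add_sub_add_comm]; exact add_mem hx hy
    | neg x _ hx => rw [neg_mul, mul_neg, ← neg_sub']; exact neg_mem hx
  rw [← SetLike.mem_coe, hab.mulCentroid_eq_centroidSpanOne hL hb hbZ] at this
  exact this

/-- For `b ∈ L`, the inner derivation of `b` maps `[RC, RC]` to `C`. -/
theorem IsAbelianLie.commutator_mem_extendedCentroid (hab : IsAbelianLie L) (hL : IsLieIdeal L)
    {b : R} (hb : b ∈ L) (hbZ : b ∉ NonUnitalSubring.center R) {q : SymQuot R}
    (hq : q ∈ commutatorSpan (centralClosure R) (centralClosure R)) :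
    ofRing R b * q - q * ofRing R b ∈ extendedCentroid R := by
  induction hq using AddSubgroup.closure_induction with
  | mem q hq =>
    obtain ⟨x, hx, y, hy, rfl⟩ := hq
    obtain ⟨c, hc, d, hd, h⟩ := hab.exists_commutator_eq_mul_add hL hb hbZ hx
    obtain ⟨c', hc', d', hd', h'⟩ := hab.exists_commutator_eq_mul_add hL hb hbZ hy
    set B := ofRing R b
    -- By Leibniz, `[B, [x, y]] = c [B, y] - c' [B, x]`, where the two terms `c c' B` cancel.
    have e1 : B * (x * y - y * x) - (x * y - y * x) * B =
        (B * x - x * B) * y - y * (B * x - x * B) + (x * (B * y - y * B)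
          - (B * y - y * B) * x) := by
      noncomm_ring
    have e2 : (B * x - x * B) * y - y * (B * x - x * B) = c * (B * y - y * B) := by
      rw [h, add_mul, mul_add, mul_sub, Subring.mem_center_iff.1 hd y, ← mul_assoc y,
        Subring.mem_center_iff.1 hc y, mul_assoc, mul_assoc]
      abel
    have e3 : x * (B * y - y * B) - (B * y - y * B) * x = -(c' * (B * x - x * B)) := by
      rw [h', add_mul, mul_add, mul_sub, Subring.mem_center_iff.1 hd' x, ← mul_assoc x,
        Subring.mem_center_iff.1 hc' x, mul_assoc, mul_assoc]
      abel
    have e4 : c * (c' * B + d') + -(c' * (c * B + d)) = c * d' - c' * d := by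
      rw [mul_add, mul_add, ← mul_assoc, ← mul_assoc, Subring.mem_center_iff.1 hc c']
      abel
    rw [e1, e2, e3, h, h', e4]
    exact sub_mem (mul_mem hc hd') (mul_mem hc' hd)
  | zero => rw [zero_mul, mul_zero, sub_zero]; exact zero_mem _
  | add x y _ _ hx hy =>
    rw [add_mul, mul_add, add_sub_add_comm]; exact add_mem hx hy
  | neg x _ hx => rw [neg_mul, mul_neg, ← neg_sub']; exact neg_mem hx

/-- A nonzero central `u²` is invertible in `C`, and `u (u²)⁻¹` inverts `u`. Conversely, `uv = 1`
and `u² = 0` give `1 = u (uv) v = 0`. -/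
theorem isUnitOfCentralClosure_ofRing_iff {u : R} (hu : u * u ∈ NonUnitalSubring.center R) :
    IsUnitOfCentralClosure (ofRing R u) ↔ u * u ≠ 0 := by
  have h1 : ofRing R u ∈ centralClosure R := by
    have := ofRing_mul_mem_mulCentroid (AddSubgroup.mem_top u) (one_mem (extendedCentroid R))
    rwa [mul_one] at this
  constructor
  · rintro ⟨-, v, -, huv, -⟩ h0
    obtain ⟨x, hx⟩ := exists_ne (0 : R)
    have hQ : ofRing R u * (ofRing R u * v) * v = 0 := by
      rw [← mul_assoc, ← map_mul, h0, map_zero, zero_mul, zero_mul]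
    rw [huv, mul_one, huv] at hQ
    apply hx
    apply ofRing_injective
    rw [map_zero, ← one_mul (ofRing R x), hQ, zero_mul]
  · intro h0
    obtain ⟨e, he, hue⟩ := exists_inverse_ofRing hu h0
    rw [map_mul] at hue
    refine ⟨h1, ofRing R u * e, mul_mem_mulCentroid h1 he, by rw [← mul_assoc, hue], ?_⟩
    rw [mul_assoc, ← Subring.mem_center_iff.1 he, ← mul_assoc, hue]

end CentralClosure

theorem theoremB {R : Type*} [NonUnitalRing R] [IsPrimeRing R] (L : AddSubgroup R)
    (hL : IsLieIdeal L) (hLZ : ¬ IsCentralLie L) (a : R) :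
    (¬ IsAbelianLie L → a ∉ NonUnitalSubring.center R →
      ContainsNonzeroIdeal (addMulLeft L a)) ∧
    (IsAbelianLie L →
      -- `LC = Cb + C` for some noncentral `b ∈ L`
      (∃ b ∈ L, b ∉ NonUnitalSubring.center R ∧
        (mulCentroid L : Set (SymQuot R)) = centroidSpanOne b) ∧
      -- the case `a ∈ LC`
      (SymQuot.ofRing R a ∈ mulCentroid L →
        ¬ ContainsNonzeroIdeal (addMulLeft L a)) ∧
      -- the case `a ∈ [RC, RC] \ LC`
      (SymQuot.ofRing R a ∈ commutatorSpan (centralClosure R) (centralClosure R) →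
        SymQuot.ofRing R a ∉ mulCentroid L →
        ContainsNonzeroIdeal (addMulLeft L a)) ∧
      -- the case `a ∉ [RC, RC]`, for every `b` as above
      (SymQuot.ofRing R a ∉ commutatorSpan (centralClosure R) (centralClosure R) →
        ∀ b ∈ L, b ∉ NonUnitalSubring.center R →
          (mulCentroid L : Set (SymQuot R)) = centroidSpanOne b →
          (ContainsNonzeroIdeal (addMulLeft L a) ↔
            IsUnitOfCentralClosure (SymQuot.ofRing R (a * b - b * a))))) := by
  refine ⟨fun hab ha => hL.containsNonzeroIdeal_of_not_isAbelianLie hab ha, fun hab => ?_⟩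
  simp only [IsCentralLie, not_forall] at hLZ
  obtain ⟨b, hb, hbZ⟩ := hLZ
  refine ⟨⟨b, hb, hbZ, hab.mulCentroid_eq_centroidSpanOne hL hb hbZ⟩, fun ha => ?_,
    fun ha haL => ?_, fun _ b' hb' hbZ' _ => ?_⟩
  · have h := hab.commutator_eq_zero_of_mem_mulCentroid hb ha
    rw [← map_mul, ← map_mul, SymQuot.ofRing_injective.eq_iff] at h
    rw [hab.containsNonzeroIdeal_iff hL hb hbZ, h, sub_self, mul_zero]
    exact not_not_intro rfl
  · have h := hab.commutator_mem_extendedCentroid hL hb hbZ ha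
    rw [← map_mul, ← map_mul, ← map_sub, SymQuot.ofRing_mem_extendedCentroid] at h
    rw [hab.containsNonzeroIdeal_iff hL hb hbZ, ← neg_sub, neg_mul_neg]
    intro h0
    -- The commutator `[b, a]` is central, so a zero square makes it zero; then `a` centralizes `b`
    -- and lies in `LC`.
    exact haL (hab.ofRing_mem_mulCentroid_of_commute hL hb hbZ
      (sub_eq_zero.1 (IsPrimeRing.eq_zero_of_mul_self_mem_center h h0)))
  · rw [hab.containsNonzeroIdeal_iff hL hb' hbZ', isUnitOfCentralClosure_ofRing_iff]
    exact hab.mul_self_mem_center hL hb' hbZ' (hL.commutator_mem' hb' a)
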